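/- Every odd positive integer $n$ distinct from $1, 3, 5$ and $9$ satisfies Robin's inequality $$\sigma(n) < e^{\gamma}\, n \log\log n,$$ where $\sigma(n)=\sum_{d\mid n} d$ is the sum of the positive divisors of $n$ and $\gamma$ is the Euler(-Mascheroni) constant. -/

import Mathlib

/-- Robin's inequality `σ(n) < e^γ n log log n`, where `σ(n)` is the sum of the positive divisors
of `n` and `γ` is Euler's constant. -/
def RobinInequality (n : ℕ) : Prop :=
  (ArithmeticFunction.sigma 1 n : ℝ) <
    Real.exp Real.eulerMascheroniConstant * n * Real.log (Real.log n)

/-- The set of integers `n ≥ 1` that satisfy Robin's inequality. -/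
def robinSet : Set ℕ := {n | 1 ≤ n ∧ RobinInequality n}

/-!
Since `σ(n) / n ≤ ∏_{p ∣ n} p / (p - 1)` and `7 / 4 < e^γ`, it suffices to bound this Euler product
by `7 / 4 * log log n`.

If `23 ≤ log n`, let `N` be the larger of `128` and `⌊log n⌋`. By Mertens' theorem the odd primes up
to `N` contribute about `e^γ / 2 * log N`, because the factor `2` of the prime `2` is missing, so
there is room for the weak bound `7 / 5 * log N`. It follows from the prime factorization of `N!`,
Stirling's formula, Chebyshev's bound for `θ` and partial summation started at `128`. The prime
factors of `n` above `N` number at most `log n / log N` and contribute at most a factor `31 / 25`,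
and `7 / 5 * 31 / 25 < 7 / 4`. For `log n < 128`, where `log N` exceeds `log log n`, the product
over the odd primes up to `128` is instead evaluated to be at most `22 / 5`.

If `log n < 23`, then `n` has at most nine distinct prime factors: the `i`-th one (from `i = 0`) is
at least `2 * i + 3` and `3 * 5 * ⋯ * 21 > e ^ 23`. In that case the crude bound
`∏ i < k, (2 * i + 3) / (2 * i + 2)` for the Euler product over `k` odd primes is enough, apart from
a few `n < 19`.
-/

open Finset Real

theorem exp_le_of_pow_le {x r : ℝ} (a b : ℕ) (hx : b * x ≤ a := by norm_num)
    (hb : b ≠ 0 := by norm_num) (hr : 0 ≤ r := by norm_num)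
    (h : (2.7182818286 : ℝ) ^ a ≤ r ^ b := by norm_num) : exp x ≤ r := by
  refine le_of_pow_le_pow_left₀ hb hr ?_
  calc exp x ^ b = exp (b * x) := (exp_nat_mul x b).symm
    _ ≤ exp a := exp_le_exp.2 hx
    _ = exp 1 ^ a := by rw [← exp_nat_mul, mul_one]
    _ ≤ 2.7182818286 ^ a := pow_le_pow_left₀ (exp_pos 1).le exp_one_lt_d9.le a
    _ ≤ r ^ b := h

theorem le_exp_of_pow_le {x r : ℝ} (a b : ℕ) (hx : a ≤ b * x := by norm_num)
    (hb : b ≠ 0 := by norm_num) (h : r ^ b ≤ (2.7182818283 : ℝ) ^ a := by norm_num) :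
    r ≤ exp x := by
  refine le_of_pow_le_pow_left₀ hb (exp_pos x).le ?_
  calc r ^ b ≤ 2.7182818283 ^ a := h
    _ ≤ exp 1 ^ a := pow_le_pow_left₀ (by norm_num) exp_one_gt_d9.le a
    _ = exp a := by rw [← exp_nat_mul, mul_one]
    _ ≤ exp (b * x) := exp_le_exp.2 hx
    _ = exp x ^ b := exp_nat_mul x b

theorem seven_fourths_lt_exp_eulerMascheroniConstant : 7 / 4 < exp eulerMascheroniConstant := by
  have h_harmonic : (4027 / 1000 : ℝ) < harmonic 31 := by
    norm_num [harmonic, sum_range_succ]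
  have h_log : log 32 = 5 * log 2 := by
    rw [show (32 : ℝ) = 2 ^ 5 by norm_num, log_pow, Nat.cast_ofNat]
  have h_gamma : 14 / 25 < eulerMascheroniConstant := by
    calc (14 / 25 : ℝ) < harmonic 31 - log 32 := by
          rw [h_log]; linarith [log_two_lt_d9]
      _ = eulerMascheroniSeq 31 := by norm_num [eulerMascheroniSeq]
      _ < eulerMascheroniConstant := eulerMascheroniSeq_lt_eulerMascheroniConstant 31
  exact (le_exp_of_pow_le 14 25).trans_lt (exp_lt_exp.2 h_gamma)

/-- The Euler product `∏ p / (p - 1)` over a finite set `S`. It is meant for sets of primes; the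
factors `0` and `1` of `S` contribute `0` (for `p = 1` because `1 / 0 = 0`). -/
noncomputable def eulerProd (S : Finset ℕ) : ℝ := ∏ p ∈ S, (p : ℝ) / (p - 1)

theorem div_sub_one_eq_one_add {x : ℝ} (hx : x ≠ 1) : x / (x - 1) = 1 + 1 / (x - 1) := by
  have : x - 1 ≠ 0 := sub_ne_zero.2 hx
  field_simp
  ring

theorem div_sub_one_le_div_sub_one {x y : ℝ} (hx : 1 < x) (hxy : x ≤ y) :
    y / (y - 1) ≤ x / (x - 1) := by
  rw [div_sub_one_eq_one_add hx.ne', div_sub_one_eq_one_add (hx.trans_le hxy).ne']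
  gcongr

theorem one_le_div_sub_one {x : ℝ} (hx : 1 < x) : 1 ≤ x / (x - 1) := by
  rw [one_le_div (by linarith)]
  linarith

theorem eulerProd_nonneg (S : Finset ℕ) : 0 ≤ eulerProd S := by
  refine prod_nonneg fun p _ => ?_
  rcases p.eq_zero_or_pos with rfl | hp
  · simp
  · have : (1 : ℝ) ≤ p := by exact_mod_cast hp
    exact div_nonneg p.cast_nonneg (by linarith)

theorem eulerProd_mono {S T : Finset ℕ} (h : S ⊆ T) (hT : ∀ p ∈ T, 1 < p) :
    eulerProd S ≤ eulerProd T := by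
  rw [eulerProd, eulerProd, ← prod_sdiff h]
  exact le_mul_of_one_le_left (eulerProd_nonneg S) <| one_le_prod fun p hp =>
    one_le_div_sub_one (by exact_mod_cast hT p (mem_sdiff.1 hp).1)

theorem eulerProd_le_exp_sum {S : Finset ℕ} (hS : ∀ p ∈ S, 1 < p) :
    eulerProd S ≤ exp (∑ p ∈ S, 1 / ((p : ℝ) - 1)) := by
  rw [exp_sum]
  refine prod_le_prod (fun p hp => ?_) fun p hp => ?_
  · exact zero_le_one.trans (one_le_div_sub_one (by exact_mod_cast hS p hp))
  · rw [div_sub_one_eq_one_add (by exact_mod_cast (hS p hp).ne'), add_comm]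
    exact add_one_le_exp _

theorem sigma_one_le_eulerProd_mul {n : ℕ} (hn : n ≠ 0) :
    (ArithmeticFunction.sigma 1 n : ℝ) ≤ eulerProd n.primeFactors * n := by
  have h_factor (p k : ℕ) (hp : p.Prime) :
      ∑ i ∈ range (k + 1), (p : ℝ) ^ i ≤ p / (p - 1) * p ^ k := by
    have hp1 : (1 : ℝ) < p := by exact_mod_cast hp.one_lt
    rw [geom_sum_eq hp1.ne', div_mul_eq_mul_div, ← pow_succ']
    gcongr
    linarith
  calc (ArithmeticFunction.sigma 1 n : ℝ)
      = ∏ p ∈ n.primeFactors, ∑ i ∈ range (n.factorization p + 1), (p : ℝ) ^ i := by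
        rw [ArithmeticFunction.sigma_eq_prod_primeFactors_sum_range_factorization_pow_mul hn]
        simp only [mul_one, Nat.cast_prod, Nat.cast_sum, Nat.cast_pow]
    _ ≤ ∏ p ∈ n.primeFactors, ((p : ℝ) / (p - 1) * p ^ n.factorization p) :=
        prod_le_prod (fun p _ => by positivity) fun p hp =>
          h_factor p _ (Nat.prime_of_mem_primeFactors hp)
    _ = eulerProd n.primeFactors * n := by
        rw [prod_mul_distrib, eulerProd]
        congr 1
        exact_mod_cast (Nat.prod_factorization_pow_eq_self hn)

theorem robinInequality_of_le_log_log {n : ℕ} {s : ℝ}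
    (hσ : (ArithmeticFunction.sigma 1 n : ℝ) ≤ s * n) (hpos : 0 < log (log n))
    (hs : s ≤ 7 / 4 * log (log n)) : RobinInequality n := by
  have hn : (0 : ℝ) < n := by
    rcases n.eq_zero_or_pos with rfl | h
    · simp at hpos
    · exact_mod_cast h
  calc (ArithmeticFunction.sigma 1 n : ℝ) ≤ s * n := hσ
    _ ≤ 7 / 4 * n * log (log n) := by nlinarith
    _ < exp eulerMascheroniConstant * n * log (log n) := by
        gcongr
        exact seven_fourths_lt_exp_eulerMascheroniConstant

theorem le_log_log {t u x : ℝ} (ht : exp t ≤ u) (hu : exp u ≤ x) : t ≤ log (log x) := by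
  have hux : u ≤ log x := (le_log_iff_exp_le ((exp_pos u).trans_le hu)).2 hu
  exact (le_log_iff_exp_le (((exp_pos t).trans_le ht).trans_le hux)).2 (ht.trans hux)

theorem two_mul_add_three_le_orderEmbOfFin {S : Finset ℕ} {k : ℕ} (hS : ∀ p ∈ S, Odd p ∧ 1 < p)
    (hk : #S = k) (i : Fin k) : 2 * (i : ℕ) + 3 ≤ S.orderEmbOfFin hk i := by
  obtain ⟨i, hi⟩ := i
  induction i with
  | zero =>
    obtain ⟨⟨j, hj⟩, h1⟩ := hS _ (S.orderEmbOfFin_mem hk ⟨0, hi⟩)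
    dsimp only
    lia
  | succ i ih =>
    have h_prev := ih (by lia)
    have h_lt : S.orderEmbOfFin hk ⟨i, by lia⟩ < S.orderEmbOfFin hk ⟨i + 1, hi⟩ :=
      (S.orderEmbOfFin hk).strictMono (by simp)
    obtain ⟨⟨j, hj⟩, -⟩ := hS _ (S.orderEmbOfFin_mem hk ⟨i, by lia⟩)
    obtain ⟨⟨j', hj'⟩, -⟩ := hS _ (S.orderEmbOfFin_mem hk ⟨i + 1, hi⟩)
    dsimp only at h_prev ⊢
    lia

theorem prod_eq_prod_orderEmbOfFin {M : Type*} [CommMonoid M] (S : Finset ℕ) (f : ℕ → M) :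
    ∏ p ∈ S, f p = ∏ i : Fin #S, f (S.orderEmbOfFin rfl i) := by
  conv_lhs => rw [← S.map_orderEmbOfFin_univ rfl]
  rw [prod_map]
  rfl

theorem prod_range_le_prod_of_odd {S : Finset ℕ} {k : ℕ} (hS : ∀ p ∈ S, Odd p ∧ 1 < p)
    (hk : k ≤ #S) : ∏ i ∈ range k, (2 * i + 3) ≤ ∏ p ∈ S, p :=
  calc ∏ i ∈ range k, (2 * i + 3) ≤ ∏ i ∈ range #S, (2 * i + 3) :=
        prod_le_prod_of_subset_of_one_le' (range_subset_range.2 hk) fun _ _ _ => by lia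
    _ = ∏ i : Fin #S, (2 * (i : ℕ) + 3) := prod_range _
    _ ≤ ∏ i : Fin #S, S.orderEmbOfFin rfl i :=
        prod_le_prod' fun i _ => two_mul_add_three_le_orderEmbOfFin hS rfl i
    _ = ∏ p ∈ S, p := (prod_eq_prod_orderEmbOfFin S id).symm

theorem eulerProd_le_prod_range_of_odd {S : Finset ℕ} {k : ℕ} (hS : ∀ p ∈ S, Odd p ∧ 1 < p)
    (hk : #S ≤ k) : eulerProd S ≤ ∏ i ∈ range k, (2 * i + 3 : ℝ) / (2 * i + 2) := by
  have h_mono : Monotone fun k => ∏ i ∈ range k, (2 * i + 3 : ℝ) / (2 * i + 2) := by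
    refine monotone_nat_of_le_succ fun k => ?_
    rw [prod_range_succ]
    refine le_mul_of_one_le_right (by positivity) ?_
    rw [one_le_div (by positivity)]
    linarith
  calc eulerProd S
      = ∏ i : Fin #S, ((S.orderEmbOfFin rfl i : ℝ) / (S.orderEmbOfFin rfl i - 1)) :=
        prod_eq_prod_orderEmbOfFin S fun p => (p : ℝ) / (p - 1)
    _ ≤ ∏ i : Fin #S, (2 * (i : ℕ) + 3 : ℝ) / (2 * (i : ℕ) + 2) := by
        refine prod_le_prod (fun i _ => ?_) fun i _ => ?_
        · exact zero_le_one.trans (one_le_div_sub_one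
            (by exact_mod_cast (hS _ (S.orderEmbOfFin_mem rfl i)).2))
        · have h_le : (2 * (i : ℕ) + 3 : ℝ) ≤ S.orderEmbOfFin rfl i := by
            exact_mod_cast two_mul_add_three_le_orderEmbOfFin hS rfl i
          rw [show (2 * (i : ℕ) + 2 : ℝ) = 2 * (i : ℕ) + 3 - 1 by ring]
          exact div_sub_one_le_div_sub_one (by linarith [(i : ℕ).cast_nonneg (α := ℝ)]) h_le
    _ = ∏ i ∈ range #S, (2 * i + 3 : ℝ) / (2 * i + 2) :=
        (prod_range fun i => (2 * i + 3 : ℝ) / (2 * i + 2)).symm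
    _ ≤ ∏ i ∈ range k, (2 * i + 3 : ℝ) / (2 * i + 2) := h_mono hk

theorem prod_pow_div_dvd_factorial (N : ℕ) :
    ∏ p ∈ Ioc 0 N with p.Prime, p ^ (N / p) ∣ N.factorial := by
  refine prod_dvd_of_isRelPrime (fun p hp q hq hpq => ?_) fun p hp => ?_
  · rw [mem_coe, mem_filter] at hp hq
    rw [Function.onFun, ← Nat.coprime_iff_isRelPrime]
    exact Nat.coprime_pow_primes _ _ hp.2 hq.2 hpq
  · have h_lt : Nat.log p N < Nat.log p N + 2 := by lia
    rw [(mem_filter.1 hp).2.pow_dvd_factorial_iff h_lt]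
    exact (pow_one p ▸ single_le_sum (f := fun i => N / p ^ i) (fun _ _ => Nat.zero_le _)
      (mem_Ico.2 ⟨le_rfl, Nat.lt_add_of_pos_left (Nat.succ_pos _)⟩) :)

theorem sum_log_mul_div_le_log_factorial (N : ℕ) :
    ∑ p ∈ Ioc 0 N with p.Prime, log p * (N / p : ℕ) ≤ log N.factorial := by
  have h_pos : ∀ p ∈ {p ∈ Ioc 0 N | p.Prime}, (0 : ℝ) < (p : ℝ) ^ (N / p) := fun p hp => by
    have := (mem_filter.1 hp).2.pos
    positivity
  calc ∑ p ∈ Ioc 0 N with p.Prime, log p * (N / p : ℕ)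
      = log (∏ p ∈ Ioc 0 N with p.Prime, (p : ℝ) ^ (N / p)) := by
        rw [log_prod fun p hp => (h_pos p hp).ne']
        exact sum_congr rfl fun p _ => by rw [log_pow, mul_comm]
    _ ≤ log N.factorial := by
        refine log_le_log (prod_pos h_pos) ?_
        exact_mod_cast Nat.le_of_dvd N.factorial_pos (prod_pow_div_dvd_factorial N)

theorem log_factorial_le (n : ℕ) : log n.factorial ≤ n * log n - n + √n := by
  obtain _ | n := n
  · simp
  have h_stirling : log (Stirling.stirlingSeq (n + 1)) ≤ log (Stirling.stirlingSeq 1) :=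
    Stirling.log_stirlingSeq'_antitone n.zero_le
  have h_sqrt : 1 / 2 * log (n + 1 : ℕ) + 1 ≤ √(n + 1 : ℕ) := by
    have := log_le_sub_one_of_pos (sqrt_pos.2 (n.cast_add_one_pos (α := ℝ)))
    rw [log_sqrt (by positivity)] at this
    push_cast
    linarith
  have h_one : log (Stirling.stirlingSeq 1) = 1 - 1 / 2 * log 2 := by
    rw [Stirling.stirlingSeq_one, log_div (exp_ne_zero 1) (by positivity), log_exp,
      log_sqrt zero_le_two]
    ring
  rw [h_one, Stirling.log_stirlingSeq_formula, log_mul two_ne_zero (by positivity),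
    log_div (by positivity) (exp_ne_zero 1), log_exp] at h_stirling
  linarith

theorem sum_log_div_primes_le {N : ℕ} (hN : N ≠ 0) :
    ∑ p ∈ Ioc 0 N with p.Prime, log p / p ≤ log N + (log 4 - 1 + 1 / √N) := by
  have hN0 : (0 : ℝ) < N := by positivity
  have h_floor : ∀ p : ℕ, N * (log p / p) ≤ log p * (N / p : ℕ) + log p := fun p =>
    calc N * (log p / p) = log p * (N / p) := by ring
      _ ≤ log p * ((N / p : ℕ) + 1) := by
          gcongr
          rw [← Nat.floor_div_eq_div (K := ℝ)]
          exact (Nat.lt_floor_add_one _).le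
      _ = log p * (N / p : ℕ) + log p := by ring
  refine le_of_mul_le_mul_left ?_ hN0
  calc N * ∑ p ∈ Ioc 0 N with p.Prime, log p / p
      ≤ ∑ p ∈ Ioc 0 N with p.Prime, log p * (N / p : ℕ) + Chebyshev.theta N := by
        rw [mul_sum, Chebyshev.theta, Nat.floor_natCast, ← sum_add_distrib]
        exact sum_le_sum fun p _ => h_floor p
    _ ≤ (N * log N - N + √N) + log 4 * N :=
        add_le_add ((sum_log_mul_div_le_log_factorial N).trans (log_factorial_le N))
          (Chebyshev.theta_le_log4_mul_x N.cast_nonneg)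
    _ = N * (log N + (log 4 - 1 + 1 / √N)) := by
        have h_sqrt : N * (1 / √N) = √N := by rw [mul_one_div, div_sqrt]
        linear_combination -h_sqrt

/- Abel summation: raising `n` by one adds `a (n + 1) / g (n + 1)` to the sum and lowers
`(g n - g m + B - ∑ a) / g n` by at least as much, up to `log (g (n + 1)) - log (g n)`. -/
theorem sum_div_le_log_sub_log_add {a g : ℕ → ℝ} {m N : ℕ} {B : ℝ} (hmN : m ≤ N)
    (hg0 : 0 < g m) (hg : MonotoneOn g (Set.Ici m))
    (ha : ∀ n, m ≤ n → ∑ k ∈ Ioc m n, a k ≤ g n - g m + B) :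
    ∑ k ∈ Ioc m N, a k / g k ≤ log (g N) - log (g m) + B / g m := by
  have hgpos : ∀ n, m ≤ n → 0 < g n := fun n hn => hg0.trans_le (hg Set.self_mem_Ici hn hn)
  suffices h : ∑ k ∈ Ioc m N, a k / g k + (g N - g m + B - ∑ k ∈ Ioc m N, a k) / g N ≤
      log (g N) - log (g m) + B / g m by
    have := div_nonneg (sub_nonneg.2 (ha N hmN)) (hgpos N hmN).le
    linarith
  induction N, hmN using Nat.le_induction with
  | base => simp
  | succ n hn ih =>
    have hn0 := hgpos n hn
    have hn1 := hgpos (n + 1) (by lia)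
    have h_le : g n ≤ g (n + 1) := hg hn (Set.mem_Ici.2 (by lia)) n.le_succ
    have h_nonneg := sub_nonneg.2 (ha n hn)
    rw [sum_Ioc_succ_top hn, sum_Ioc_succ_top hn]
    set D := g n - g m + B - ∑ k ∈ Ioc m n, a k with hD
    have h_log : 1 - g n / g (n + 1) ≤ log (g (n + 1)) - log (g n) := by
      have := one_sub_inv_le_log_of_pos (div_pos hn1 hn0)
      rwa [inv_div, log_div hn1.ne' hn0.ne'] at this
    have h_anti : D / g (n + 1) ≤ D / g n := by gcongr
    have h_step : a (n + 1) / g (n + 1) +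
        (g (n + 1) - g m + B - (∑ k ∈ Ioc m n, a k + a (n + 1))) / g (n + 1) =
        D / g (n + 1) + (1 - g n / g (n + 1)) := by
      rw [hD]
      field_simp
      ring
    linarith

theorem sum_inv_primes_le {c : ℝ} {m N : ℕ} (hm : 2 ≤ m) (hmN : m ≤ N)
    (hc : ∀ n, m ≤ n → ∑ p ∈ Ioc 0 n with p.Prime, log p / p ≤ log n + c) :
    ∑ p ∈ Ioc m N with p.Prime, 1 / (p : ℝ) ≤ log (log N) - log (log m) +
      (log m + c - ∑ p ∈ Ioc 0 m with p.Prime, log p / p) / log m := by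
  have h_mono : MonotoneOn (fun n : ℕ => log n) (Set.Ici m) := fun i hi j _ hij => by
    have : 0 < i := by have := Set.mem_Ici.1 hi; lia
    dsimp only
    gcongr
  have h := sum_div_le_log_sub_log_add (a := fun k => if k.Prime then log k / k else 0)
    (B := log m + c - ∑ p ∈ Ioc 0 m with p.Prime, log p / p) hmN
    (log_pos (by exact_mod_cast hm)) h_mono fun n hn => by
      have h_split := sum_Ioc_consecutive (fun k : ℕ => if k.Prime then log k / k else 0)
        m.zero_le hn
      have := hc n hn
      rw [sum_filter] at this ⊢
      linarith
  refine le_trans (le_of_eq ?_) h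
  rw [sum_filter]
  refine sum_congr rfl fun k hk => ?_
  have hk1 : 1 < k := by have := (mem_Ioc.1 hk).1; lia
  have : log k ≠ 0 := (log_pos (by exact_mod_cast hk1)).ne'
  split_ifs
  · field_simp
  · simp

theorem sum_Ioc_inv_sub_one_sub_inv_le (m N : ℕ) :
    ∑ k ∈ Ioc m N, (1 / ((k : ℝ) - 1) - 1 / k) ≤ 1 / m := by
  rcases lt_or_ge N m with hN | hN
  · simp [Ioc_eq_empty_of_le hN.le]
  suffices h : ∑ k ∈ Ioc m N, (1 / ((k : ℝ) - 1) - 1 / k) = 1 / m - 1 / N by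
    rw [h]
    exact sub_le_self _ (by positivity)
  induction N, hN using Nat.le_induction with
  | base => simp
  | succ n hn ih =>
    rw [sum_Ioc_succ_top hn, ih]
    push_cast
    ring

theorem eulerProd_primes_Ioc_le {m : ℕ} (N : ℕ) (hm : m ≠ 0) :
    eulerProd {p ∈ Ioc m N | p.Prime} ≤
      exp (∑ p ∈ Ioc m N with p.Prime, 1 / (p : ℝ) + 1 / m) := by
  refine (eulerProd_le_exp_sum fun p hp => (mem_filter.1 hp).2.one_lt).trans (exp_le_exp.2 ?_)
  have h_nonneg : ∀ k ∈ Ioc m N, 0 ≤ 1 / ((k : ℝ) - 1) - 1 / k := fun k hk => by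
    have : (1 : ℝ) < k := by
      exact_mod_cast (Nat.one_le_iff_ne_zero.2 hm).trans_lt (mem_Ioc.1 hk).1
    exact sub_nonneg.2 (one_div_le_one_div_of_le (by linarith) (by linarith))
  have h := (sum_le_sum_of_subset_of_nonneg (filter_subset Nat.Prime _)
    fun k hk _ => h_nonneg k hk).trans (sum_Ioc_inv_sub_one_sub_inv_le m N)
  rw [sum_sub_distrib] at h
  linarith

theorem natLog_div_mul_log_le_log {b e : ℕ} (n : ℕ) (hb : 1 < b) (he : e ≠ 0) :
    (Nat.log b (n ^ e) : ℝ) / e * log b ≤ log n := by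
  have hb' : 0 < log b := log_pos (by exact_mod_cast hb)
  have h := natLog_le_logb (n ^ e) b
  rw [logb, le_div_iff₀ hb', Nat.cast_pow, log_pow] at h
  rw [div_mul_eq_mul_div, div_le_iff₀ (by positivity), mul_comm (log (n : ℝ))]
  exact h

theorem log_two_mul_le_sum_log_div_primes_128 :
    49 / 10 * log 2 ≤ ∑ p ∈ Ioc 0 (128 : ℕ) with p.Prime, log p / p := by
  -- `log p` is replaced by `⌊2 log₂ p⌋ / 2 * log 2`, which leaves an inequality of rationals.
  have h_rat : (49 / 10 : ℚ) ≤
      ∑ p ∈ Ioc 0 (128 : ℕ) with p.Prime, (Nat.log 2 (p ^ 2) : ℚ) / 2 / p := by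
    decide +kernel
  calc 49 / 10 * log 2 ≤
      (∑ p ∈ Ioc 0 (128 : ℕ) with p.Prime, (Nat.log 2 (p ^ 2) : ℝ) / 2 / p) * log 2 := by
        gcongr
        simpa using (Rat.cast_le (K := ℝ)).2 h_rat
    _ = ∑ p ∈ Ioc 0 (128 : ℕ) with p.Prime, (Nat.log 2 (p ^ 2) : ℝ) / 2 * log 2 / p := by
        rw [sum_mul]
        exact sum_congr rfl fun p _ => div_mul_eq_mul_div _ _ _
    _ ≤ ∑ p ∈ Ioc 0 (128 : ℕ) with p.Prime, log p / p := by
        gcongr with p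
        exact natLog_div_mul_log_le_log p one_lt_two two_ne_zero

theorem eulerProd_odd_primes_128_le : eulerProd {p ∈ Ioc 2 128 | p.Prime} ≤ 22 / 5 := by
  have h_rat : ∏ p ∈ Ioc 2 (128 : ℕ) with p.Prime, (p : ℚ) / (p - 1) ≤ 22 / 5 := by decide +kernel
  rw [eulerProd]
  simpa using (Rat.cast_le (K := ℝ)).2 h_rat

theorem eulerProd_primes_Ioc_mul {l m N : ℕ} (hlm : l ≤ m) (hmN : m ≤ N) :
    eulerProd {p ∈ Ioc l m | p.Prime} * eulerProd {p ∈ Ioc m N | p.Prime} =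
      eulerProd {p ∈ Ioc l N | p.Prime} := by
  simp only [eulerProd, prod_filter]
  exact prod_Ioc_consecutive _ hlm hmN

theorem sum_log_div_primes_le_log_add_half {n : ℕ} (hn : 128 ≤ n) :
    ∑ p ∈ Ioc 0 n with p.Prime, log p / p ≤ log n + 1 / 2 := by
  have h_log : log 4 = 2 * log 2 := by
    rw [show (4 : ℝ) = 2 ^ 2 by norm_num, log_pow, Nat.cast_ofNat]
  have h_sqrt : 1 / √(n : ℝ) ≤ 1 / 10 := by
    refine one_div_le_one_div_of_le (by norm_num) (le_sqrt_of_sq_le ?_)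
    have : (128 : ℝ) ≤ n := by exact_mod_cast hn
    linarith
  linarith [sum_log_div_primes_le (by lia : n ≠ 0), log_two_lt_d9]

theorem log_128_eq : log 128 = 7 * log 2 := by
  rw [show (128 : ℝ) = 2 ^ 7 by norm_num, log_pow, Nat.cast_ofNat]

theorem eulerProd_primes_Ioc_128_le {N : ℕ} (hN : 128 ≤ N) :
    eulerProd {p ∈ Ioc 128 N | p.Prime} ≤ 77 / 50 * (log N / log 128) := by
  have h_pos : 0 < log 128 := log_pos (by norm_num)
  have h_posN : 0 < log N := log_pos (by exact_mod_cast (by lia : 1 < N))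
  have h_mertens : ∑ p ∈ Ioc 128 N with p.Prime, 1 / (p : ℝ) ≤ log (log N / log 128) +
      (log 128 + 1 / 2 - ∑ p ∈ Ioc 0 (128 : ℕ) with p.Prime, log p / p) / log 128 := by
    rw [log_div h_posN.ne' h_pos.ne']
    exact_mod_cast sum_inv_primes_le (by norm_num) hN fun n => sum_log_div_primes_le_log_add_half
  have h_error : (log 128 + 1 / 2 - ∑ p ∈ Ioc 0 (128 : ℕ) with p.Prime, log p / p) / log 128 ≤
      3 / 7 - 1 / 128 := by
    rw [div_le_iff₀ h_pos]
    linarith [log_two_mul_le_sum_log_div_primes_128, log_128_eq, log_two_gt_d9]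
  calc eulerProd {p ∈ Ioc 128 N | p.Prime}
      ≤ exp (∑ p ∈ Ioc 128 N with p.Prime, 1 / (p : ℝ) + 1 / 128) :=
        mod_cast eulerProd_primes_Ioc_le N (by norm_num)
    _ ≤ exp (3 / 7 + log (log N / log 128)) := exp_le_exp.2 (by linarith)
    _ = exp (3 / 7) * (log N / log 128) := by rw [exp_add, exp_log (div_pos h_posN h_pos)]
    _ ≤ 77 / 50 * (log N / log 128) := by
        gcongr
        exact exp_le_of_pow_le 3 7

theorem eulerProd_odd_primes_le {N : ℕ} (hN : 128 ≤ N) :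
    eulerProd {p ∈ Ioc 2 N | p.Prime} ≤ 7 / 5 * log N := by
  have h_posN : 0 < log N := log_pos (by exact_mod_cast (by lia : 1 < N))
  calc eulerProd {p ∈ Ioc 2 N | p.Prime}
      = eulerProd {p ∈ Ioc 2 128 | p.Prime} * eulerProd {p ∈ Ioc 128 N | p.Prime} :=
        (eulerProd_primes_Ioc_mul (by norm_num) hN).symm
    _ ≤ 22 / 5 * (77 / 50 * (log N / log 128)) :=
        mul_le_mul eulerProd_odd_primes_128_le (eulerProd_primes_Ioc_128_le hN)
          (eulerProd_nonneg _) (by norm_num)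
    _ ≤ 7 / 5 * log N := by
        rw [mul_div_assoc', mul_div_assoc', div_le_iff₀ (log_pos (by norm_num)), log_128_eq]
        nlinarith [log_two_gt_d9]

theorem sum_primeFactors_gt_le {n N : ℕ} (hn : n ≠ 0) (hN : N ≠ 0) :
    ∑ p ∈ n.primeFactors with N < p, 1 / ((p : ℝ) - 1) ≤ log n / (N * log (N + 1 : ℕ)) := by
  have hN0 : (0 : ℝ) < N := by positivity
  have h_log : 0 < log (N + 1 : ℕ) := log_pos (by exact_mod_cast (by lia : 1 < N + 1))
  set S := {p ∈ n.primeFactors | N < p}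
  have h_lt : ∀ p ∈ S, N + 1 ≤ p := fun p hp => (mem_filter.1 hp).2
  have h_card : #S * log (N + 1 : ℕ) ≤ log n := by
    have h_pow : (N + 1) ^ #S ≤ n :=
      calc (N + 1) ^ #S ≤ ∏ p ∈ S, p := pow_card_le_prod _ _ _ h_lt
        _ ≤ n := Nat.le_of_dvd (Nat.pos_of_ne_zero hn) <|
          (prod_dvd_prod_of_subset _ _ _ (filter_subset _ _)).trans n.prod_primeFactors_dvd
    rw [← log_pow]
    exact log_le_log (by positivity) (by exact_mod_cast h_pow)
  calc ∑ p ∈ S, 1 / ((p : ℝ) - 1) ≤ #S • (1 / (N : ℝ)) := by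
        refine sum_le_card_nsmul _ _ _ fun p hp => one_div_le_one_div_of_le hN0 ?_
        have : (N + 1 : ℝ) ≤ p := by exact_mod_cast h_lt p hp
        linarith
    _ ≤ log n / (N * log (N + 1 : ℕ)) := by
        rw [nsmul_eq_mul, mul_one_div, div_le_div_iff₀ hN0 (by positivity)]
        nlinarith

theorem odd_and_one_lt_of_mem_primeFactors {n p : ℕ} (hodd : Odd n) (hp : p ∈ n.primeFactors) :
    Odd p ∧ 1 < p :=
  ⟨hodd.of_dvd_nat (Nat.dvd_of_mem_primeFactors hp), (Nat.prime_of_mem_primeFactors hp).one_lt⟩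

theorem eulerProd_primeFactors_le {n N : ℕ} (hodd : Odd n) (hN : 128 ≤ N) (hn : log n ≤ N + 1) :
    eulerProd n.primeFactors ≤ eulerProd {p ∈ Ioc 2 N | p.Prime} * (31 / 25) := by
  have h_small : eulerProd {p ∈ n.primeFactors | ¬ N < p} ≤ eulerProd {p ∈ Ioc 2 N | p.Prime} := by
    refine eulerProd_mono (fun p hp => ?_) fun p hp => (mem_filter.1 hp).2.one_lt
    obtain ⟨hpn, hpN⟩ := mem_filter.1 hp
    obtain ⟨⟨k, hk⟩, h1⟩ := odd_and_one_lt_of_mem_primeFactors hodd hpn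
    exact mem_filter.2 ⟨mem_Ioc.2 ⟨by lia, by lia⟩, Nat.prime_of_mem_primeFactors hpn⟩
  have h_exponent : log n / (N * log (N + 1 : ℕ)) ≤ 3 / 14 := by
    have hN' : (128 : ℝ) ≤ N := by exact_mod_cast hN
    have h_log : 33 / 7 ≤ log (N + 1 : ℕ) := by
      rw [le_log_iff_exp_le (by positivity)]
      refine (exp_le_of_pow_le (r := 129) 33 7).trans ?_
      push_cast
      linarith
    rw [div_le_iff₀ (by positivity)]
    nlinarith
  have h_large : eulerProd {p ∈ n.primeFactors | N < p} ≤ 31 / 25 :=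
    calc eulerProd {p ∈ n.primeFactors | N < p}
        ≤ exp (∑ p ∈ n.primeFactors with N < p, 1 / ((p : ℝ) - 1)) :=
          eulerProd_le_exp_sum fun p hp =>
            (odd_and_one_lt_of_mem_primeFactors hodd (mem_filter.1 hp).1).2
      _ ≤ exp (3 / 14) := exp_le_exp.2 <|
          (sum_primeFactors_gt_le hodd.pos.ne' (by lia)).trans h_exponent
      _ ≤ 31 / 25 := exp_le_of_pow_le 3 14
  calc eulerProd n.primeFactors
      = eulerProd {p ∈ n.primeFactors | ¬ N < p} * eulerProd {p ∈ n.primeFactors | N < p} := by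
        rw [eulerProd, mul_comm]
        exact (prod_filter_mul_prod_filter_not _ _ _).symm
    _ ≤ eulerProd {p ∈ Ioc 2 N | p.Prime} * (31 / 25) :=
        mul_le_mul h_small h_large (eulerProd_nonneg _) (eulerProd_nonneg _)

theorem robinInequality_of_exp_23_le {n : ℕ} (hodd : Odd n) (hn : exp 23 ≤ n) :
    RobinInequality n := by
  have h_log : 25 / 8 ≤ log (log n) := le_log_log (exp_le_of_pow_le 25 8) hn
  refine robinInequality_of_le_log_log (sigma_one_le_eulerProd_mul hodd.pos.ne')
    (by linarith) ?_
  rcases lt_or_ge (log n) 128 with h_small | h_large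
  · have := eulerProd_primeFactors_le hodd le_rfl (by push_cast; linarith)
    linarith [eulerProd_odd_primes_128_le]
  · have hN : 128 ≤ ⌊log n⌋₊ := Nat.le_floor (by exact_mod_cast h_large)
    have h_floor : log ⌊log n⌋₊ ≤ log (log n) :=
      log_le_log (by exact_mod_cast (by lia : 0 < ⌊log n⌋₊)) (Nat.floor_le (by linarith))
    have := eulerProd_primeFactors_le hodd hN (Nat.lt_floor_add_one _).le
    linarith [eulerProd_odd_primes_le hN]

theorem prod_range_le_of_le_card_primeFactors {n k : ℕ} (hodd : Odd n)
    (hk : k ≤ #n.primeFactors) : ∏ i ∈ range k, (2 * i + 3) ≤ n :=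
  (prod_range_le_prod_of_odd (fun _ => odd_and_one_lt_of_mem_primeFactors hodd) hk).trans
    (Nat.le_of_dvd hodd.pos n.prod_primeFactors_dvd)

theorem robinInequality_of_card_primeFactors_le {n k : ℕ} {t u : ℝ} (hodd : Odd n)
    (hk : #n.primeFactors ≤ k)
    (ht : ∏ i ∈ range k, (2 * i + 3 : ℝ) / (2 * i + 2) ≤ 7 / 4 * t) (ht0 : 0 < t)
    (htu : exp t ≤ u) (hun : exp u ≤ n) : RobinInequality n := by
  have h_log := le_log_log htu hun
  refine robinInequality_of_le_log_log (sigma_one_le_eulerProd_mul hodd.pos.ne')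
    (ht0.trans_le h_log) ?_
  have := eulerProd_le_prod_range_of_odd
    (fun _ => odd_and_one_lt_of_mem_primeFactors hodd) hk
  linarith

theorem robinInequality_of_prime {p : ℕ} (hp : p.Prime) (h : 11 ≤ p) : RobinInequality p := by
  have h_exp : exp (19 / 8) ≤ p :=
    (exp_le_of_pow_le (r := 11) 19 8).trans (by exact_mod_cast h)
  exact robinInequality_of_card_primeFactors_le (k := 1) (t := 6 / 7) (u := 19 / 8)
    (hp.odd_of_ne_two (by lia)) (by simp [hp.primeFactors]) (by norm_num) (by norm_num)
    (exp_le_of_pow_le 6 7) h_exp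

theorem robinInequality_seven : RobinInequality 7 := by
  have h_log : 19 / 29 ≤ log (log (7 : ℕ)) :=
    le_log_log (u := 27 / 14) (exp_le_of_pow_le 19 29) (exp_le_of_pow_le 27 14)
  have h_sigma : (ArithmeticFunction.sigma 1 7 : ℝ) = 8 / 7 * (7 : ℕ) := by
    rw [show ArithmeticFunction.sigma 1 7 = 8 by decide]
    norm_num
  exact robinInequality_of_le_log_log h_sigma.le (lt_of_lt_of_le (by norm_num) h_log)
    (by linarith)

theorem robinInequality_fifteen : RobinInequality 15 := by
  have h_log : 11 / 12 ≤ log (log (15 : ℕ)) :=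
    le_log_log (u := 8 / 3) (exp_le_of_pow_le 11 12) (exp_le_of_pow_le 8 3)
  have h_sigma : (ArithmeticFunction.sigma 1 15 : ℝ) = 8 / 5 * (15 : ℕ) := by
    rw [show ArithmeticFunction.sigma 1 15 = 24 by decide]
    norm_num
  exact robinInequality_of_le_log_log h_sigma.le (lt_of_lt_of_le (by norm_num) h_log)
    (by linarith)

theorem robinInequality_of_card_primeFactors_le_two {n : ℕ} (hodd : Odd n) (hn : 19 ≤ n)
    (hk : #n.primeFactors ≤ 2) : RobinInequality n := by
  have h_exp : exp (44 / 15) ≤ n :=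
    (exp_le_of_pow_le (r := 19) 44 15).trans (by exact_mod_cast hn)
  exact robinInequality_of_card_primeFactors_le (t := 15 / 14) hodd hk
    (by norm_num [prod_range_succ]) (by norm_num) (exp_le_of_pow_le 15 14) h_exp

theorem robinInequality_of_three_le_card_primeFactors {n : ℕ} (hodd : Odd n)
    (hk : 3 ≤ #n.primeFactors) : RobinInequality n := by
  have h_le {k : ℕ} (hk : k ≤ #n.primeFactors) : ((∏ i ∈ range k, (2 * i + 3) : ℕ) : ℝ) ≤ n := by
    exact_mod_cast prod_range_le_of_le_card_primeFactors hodd hk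
  rcases le_or_gt #n.primeFactors 4 with h4 | h5
  · have h_exp : exp (9 / 2) ≤ n :=
      (exp_le_of_pow_le 9 2 (h := by norm_num [prod_range_succ])).trans (h_le hk)
    exact robinInequality_of_card_primeFactors_le (t := 3 / 2) hodd h4
      (by norm_num [prod_range_succ]) (by norm_num) (exp_le_of_pow_le 3 2) h_exp
  rcases le_or_gt #n.primeFactors 9 with h9 | h10
  · have h_exp : exp 9 ≤ n :=
      (exp_le_of_pow_le 9 1 (h := by norm_num [prod_range_succ])).trans (h_le h5)
    exact robinInequality_of_card_primeFactors_le (t := 21 / 10) hodd h9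
      (by norm_num [prod_range_succ]) (by norm_num) (exp_le_of_pow_le 21 10) h_exp
  · exact robinInequality_of_exp_23_le hodd <|
      (exp_le_of_pow_le 23 1 (h := by norm_num [prod_range_succ])).trans (h_le h10)

theorem theorem2 (n : ℕ) (hodd : Odd n) (h1 : n ≠ 1) (h3 : n ≠ 3) (h5 : n ≠ 5) (h9 : n ≠ 9) :
    n ∈ robinSet := by
  refine ⟨hodd.pos, ?_⟩
  rcases lt_or_ge n 19 with h_lt | h_ge
  · have h_cases : n = 7 ∨ n = 11 ∨ n = 13 ∨ n = 15 ∨ n = 17 := by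
      obtain ⟨m, hm⟩ := hodd
      lia
    rcases h_cases with rfl | rfl | rfl | rfl | rfl
    · exact robinInequality_seven
    · exact robinInequality_of_prime (by norm_num) (by norm_num)
    · exact robinInequality_of_prime (by norm_num) (by norm_num)
    · exact robinInequality_fifteen
    · exact robinInequality_of_prime (by norm_num) (by norm_num)
  rcases le_or_gt #n.primeFactors 2 with h_few | h_many
  · exact robinInequality_of_card_primeFactors_le_two hodd h_ge h_few
  · exact robinInequality_of_three_le_card_primeFactors hodd h_many
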